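/- Let $\mathbb F$ be $\mathbb R$ or $\mathbb C$, and let $X$ be a Tychonoff (completely regular Hausdorff) space. A set $K\subseteq X$ is *functionally bounded* if every continuous function $f:X\to\mathbb R$ is bounded on $K$. The space $X$ is *selectively sequentially pseudocompact at* a set $A\subseteq X$ if for every sequence $(U_n)_{n\in\omega}$ of open subsets of $X$ with $U_n\cap A\neq\emptyset$ for all $n$, there are points $x_n\in U_n$, $n\in\omega$, such that some subsequence of $(x_n)_{n\in\omega}$ converges in $X$. Let $E$ be a locally convex space over $\mathbb F$ with topological dual $E'$. A *barrel* in $E$ is a closed, absolutely convex, absorbing subset of $E$. A set $A\subseteq E$ is *barrel-bounded* if for every barrel $U$ there is $n\in\omega$ with $A\subseteq nU$, and *barrel-precompact* if for every barrel $U$ there is a finite set $F\subseteq E$ with $A\subseteq F+U$. A barrel-bounded set $A\subseteq E$ is *limited* if every sequence $(\chi_n)_{n\in\omega}$ in $E'$ which converges to $0$ in the weak$^*$ topology converges to $0$ uniformly on $A$. The space $E$ is *Gelfand–Phillips* if every limited subset of $E$ is barrel-precompact. **Theorem.** Suppose that every functionally bounded set $K\subseteq X$ is contained in a set $K'\subseteq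 X$ such that $X$ is selectively sequentially pseudocompact at $K'$. Then the space $C_p(X)$ of all continuous functions $X\to\mathbb F$, endowed with the topology of pointwise convergence, is Gelfand–Phillips. -/

import Mathlib

open Topology Filter
open scoped Pointwise

section LocallyConvex

variable (𝕜 : Type*) [RCLike 𝕜] {E : Type*} [AddCommGroup E] [Module 𝕜 E] [Module ℝ E]
  [IsScalarTower ℝ 𝕜 E] [TopologicalSpace E]

/-- A barrel in a locally convex space: a closed, absolutely convex (that is, balanced over the
scalar field and convex), absorbing set. -/
structure IsBarrel (B : Set E) : Prop where
  isClosed : IsClosed B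
  balanced : Balanced 𝕜 B
  convex : Convex ℝ B
  absorbent : Absorbent 𝕜 B

/-- Boundedness for the topology `β(E, E')`, whose neighborhood base at zero consists of
the barrels: every barrel `U` has a multiple `n U` containing `A`. -/
def IsBarrelBounded (A : Set E) : Prop :=
  ∀ U : Set E, IsBarrel 𝕜 U → ∃ n : ℕ, A ⊆ (n : 𝕜) • U

/-- Precompactness for the topology `β(E, E')`, whose neighborhood base at zero consists of
the barrels: `A` is covered by finitely many translates of every barrel. -/
def IsBarrelPrecompact (A : Set E) : Prop :=
  ∀ U : Set E, IsBarrel 𝕜 U → ∃ F : Set E, F.Finite ∧ A ⊆ F + U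

/-- A limited set: a barrel-bounded set on which every weak-* null sequence of continuous
linear functionals converges to zero uniformly. -/
def IsLimitedSet (A : Set E) : Prop :=
  IsBarrelBounded 𝕜 A ∧
    ∀ χ : ℕ → WeakDual 𝕜 E, Tendsto χ atTop (𝓝 0) →
      TendstoUniformlyOn (fun n x => χ n x) (fun _ => (0 : 𝕜)) atTop A

variable (E) in
/-- The Gelfand-Phillips property: every limited set is barrel-precompact. -/
def IsGelfandPhillips : Prop :=
  ∀ A : Set E, IsLimitedSet 𝕜 A → IsBarrelPrecompact 𝕜 A

end LocallyConvex

section Spaces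

variable {X : Type*} [TopologicalSpace X]

/-- `A` is functionally bounded in `X`: every continuous real-valued function on `X` is bounded
on `A`. -/
def IsFunctionallyBounded (A : Set X) : Prop :=
  ∀ f : X → ℝ, Continuous f → Bornology.IsBounded (f '' A)

/-- `X` is selectively sequentially pseudocompact at `A`: from any sequence of open sets meeting
`A` one can select points so that some subsequence of the selection converges in `X`. -/
def SelSeqPseudocompactAt (A : Set X) : Prop :=
  ∀ U : ℕ → Set X, (∀ n, IsOpen (U n)) → (∀ n, (U n ∩ A).Nonempty) →
    ∃ x : ℕ → X, (∀ n, x n ∈ U n) ∧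
      ∃ φ : ℕ → ℕ, StrictMono φ ∧ ∃ l : X, Tendsto (fun k => x (φ k)) atTop (𝓝 l)

variable (X) in
/-- The space `C_p(X)` of continuous scalar functions with the topology of pointwise
convergence: a linear subspace of the product `X → 𝕜`, with the subspace topology. -/
abbrev Cp (𝕜 : Type*) [RCLike 𝕜] : Type _ :=
  ↥(continuousSubmodule X 𝕜 𝕜)

end Spaces

/-! Every barrel `D` of `C_p(X)` contains all functions that are small on some functionally bounded
set `B` (`IsBarrel.exists_isFunctionallyBounded`). This comes from Baire category, applied to
bounded functions and to locally finite sums, together with closedness of the largest subspace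
inside `D`.

It remains to cover a limited set `A` up to uniform error on `B`. If `y n → l`, the functionals
"evaluation at `y n` minus evaluation at `l`" are weak-* null, so `A` is uniformly small on them.
Selective sequential pseudocompactness supplies such convergent sequences near any sequence in `B`,
which makes `B` precompact for the sup-distance over `A` (`IsLimitedSet.exists_finset_net`). Since
`A` is pointwise bounded, approximation on a finite net of `B` needs only finitely many members of
`A`. -/

theorem Absorbent.exists_nat_inv_smul_mem {𝕜 : Type*} [RCLike 𝕜] {E : Type*} [AddCommGroup E]
    [Module 𝕜 E] {D : Set E} (hD : Absorbent 𝕜 D) (x : E) :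
    ∃ n : ℕ, ((n : 𝕜) + 1)⁻¹ • x ∈ D := by
  have h := (hD x).eventually_nhds_zero hD.zero_mem
  have ht : Tendsto (fun n : ℕ => ((n : 𝕜) + 1)⁻¹) atTop (𝓝 0) := by
    simpa using tendsto_one_div_add_atTop_nhds_zero_nat (𝕜 := 𝕜)
  obtain ⟨n, hn⟩ := (ht.eventually h).exists
  exact ⟨n, hn rfl⟩

/-! ### Barrels and Baire category -/

section Barrels

variable {𝕜 : Type*} [RCLike 𝕜] {E : Type*} [AddCommGroup E] [Module 𝕜 E] [Module ℝ E]
  [IsScalarTower ℝ 𝕜 E] [TopologicalSpace E]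

namespace IsBarrel

variable {D : Set E}

theorem half_add_mem (hD : IsBarrel 𝕜 D) {a b : E} (ha : a ∈ D) (hb : b ∈ D) :
    (2⁻¹ : 𝕜) • (a + b) ∈ D := by
  have h := hD.convex ha hb (a := 2⁻¹) (b := 2⁻¹) (by norm_num) (by norm_num) (by norm_num)
  rwa [← smul_add, RCLike.real_smul_eq_coe_smul (K := 𝕜), RCLike.ofReal_inv,
    RCLike.ofReal_ofNat] at h

theorem add_mem_of_two_smul (hD : IsBarrel 𝕜 D) {a b : E} (ha : (2 : 𝕜) • a ∈ D)
    (hb : (2 : 𝕜) • b ∈ D) : a + b ∈ D := by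
  have h := hD.half_add_mem ha hb
  rwa [← smul_add, smul_smul, inv_mul_cancel₀ two_ne_zero, one_smul] at h

/-- The largest linear subspace contained in a barrel. -/
def linealitySpace (hD : IsBarrel 𝕜 D) : Submodule 𝕜 E where
  carrier := {f | ∀ c : 𝕜, c • f ∈ D}
  zero_mem' c := by simpa using hD.absorbent.zero_mem
  add_mem' {a b} ha hb c := by
    rw [smul_add]
    refine hD.add_mem_of_two_smul ?_ ?_
    · rw [smul_smul]; exact ha _
    · rw [smul_smul]; exact hb _
  smul_mem' c a ha d := by rw [smul_smul]; exact ha _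

theorem mem_linealitySpace (hD : IsBarrel 𝕜 D) {f : E} :
    f ∈ hD.linealitySpace ↔ ∀ c : 𝕜, c • f ∈ D := Iff.rfl

theorem isClosed_linealitySpace [ContinuousConstSMul 𝕜 E] (hD : IsBarrel 𝕜 D) :
    IsClosed (hD.linealitySpace : Set E) := by
  have : (hD.linealitySpace : Set E) = ⋂ c : 𝕜, (fun f => c • f) ⁻¹' D := by
    ext f; simp [mem_linealitySpace]
  rw [this]
  exact isClosed_iInter fun c => hD.isClosed.preimage (continuous_const_smul c)

/-- The preimage of a barrel under a continuous linear map from a Baire space is a neighborhood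
of zero. -/
theorem preimage_mem_nhds_zero (hD : IsBarrel 𝕜 D) {F : Type*} [AddCommGroup F] [Module 𝕜 F]
    [TopologicalSpace F] [IsTopologicalAddGroup F] [ContinuousConstSMul 𝕜 F] [BaireSpace F]
    (T : F →L[𝕜] E) : T ⁻¹' D ∈ 𝓝 0 := by
  have hne (n : ℕ) : ((n : 𝕜) + 1)⁻¹ ≠ 0 := inv_ne_zero (by exact_mod_cast n.succ_ne_zero)
  obtain ⟨n, x, hx⟩ := nonempty_interior_of_iUnion_of_closed
    (f := fun n : ℕ => (fun y : F => ((n : 𝕜) + 1)⁻¹ • y) ⁻¹' (T ⁻¹' D))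
    (fun n => (hD.isClosed.preimage T.continuous).preimage (continuous_const_smul _))
    (Set.eq_univ_of_forall fun y => by
      obtain ⟨n, hn⟩ := hD.absorbent.exists_nat_inv_smul_mem (T y)
      exact Set.mem_iUnion.2 ⟨n, by simpa using hn⟩)
  rw [mem_interior_iff_mem_nhds] at hx
  set a : 𝕜 := ((n : 𝕜) + 1)⁻¹ with ha
  have hneg : T (-(a • x)) ∈ D := by
    rw [map_neg]
    exact hD.balanced.neg_mem_iff.2 (show x ∈ (a • ·) ⁻¹' (T ⁻¹' D) from mem_of_mem_nhds hx)
  -- The factor `a⁻¹ * 2` is chosen so that averaging `a • (x + (a⁻¹ * 2) • y)` with `-(a • x)`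
  -- returns exactly `y`.
  have hcont : Tendsto (fun y : F => x + (a⁻¹ * 2) • y) (𝓝 0) (𝓝 x) := by
    have : Continuous fun y : F => x + (a⁻¹ * 2) • y :=
      continuous_const.add (continuous_const_smul _)
    simpa using this.tendsto 0
  filter_upwards [hcont hx] with y hy
  have h := hD.half_add_mem (show T (a • (x + (a⁻¹ * 2) • y)) ∈ D from hy) hneg
  rw [← map_add, ← map_smul] at h
  have e : (2⁻¹ : 𝕜) • (a • (x + (a⁻¹ * 2) • y) + -(a • x)) = y := by
    rw [smul_add a, smul_smul a, ← mul_assoc a, mul_inv_cancel₀ (hne n), one_mul,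
      add_neg_cancel_comm, smul_smul, inv_mul_cancel₀ two_ne_zero, one_smul]
  rwa [e] at h

end IsBarrel

end Barrels

/-! ### Barrels of `C_p(X)` and their supports -/

section FunctionSpaces

variable {𝕜 : Type*} [RCLike 𝕜] {X : Type*} [TopologicalSpace X]

/-- Evaluation at a point, as a continuous linear functional on `C_p(X)`. -/
def Cp.eval (x : X) : Cp X 𝕜 →L[𝕜] 𝕜 where
  toFun f := f.1 x
  map_add' _ _ := rfl
  map_smul' _ _ := rfl
  cont := (continuous_apply x).comp continuous_subtype_val

@[simp] theorem Cp.eval_apply (x : X) (f : Cp X 𝕜) : Cp.eval x f = f.1 x := rfl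

theorem Cp.continuous (f : Cp X 𝕜) : Continuous f.1 := f.2

/-- The inclusion of the bounded continuous functions with the uniform norm into `C_p(X)`. -/
def Cp.ofBounded : BoundedContinuousFunction X 𝕜 →L[𝕜] Cp X 𝕜 where
  toFun f := ⟨f, f.continuous⟩
  map_add' _ _ := rfl
  map_smul' _ _ := rfl
  cont := Continuous.subtype_mk
    BoundedContinuousFunction.continuous_coe _

theorem IsBarrel.exists_forall_norm_le_mem {D : Set (Cp X 𝕜)} (hD : IsBarrel 𝕜 D) :
    ∃ ε > 0, ∀ f : Cp X 𝕜, (∀ x, ‖f.1 x‖ ≤ ε) → f ∈ D := by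
  obtain ⟨δ, hδ, h⟩ := Metric.mem_nhds_iff.1 (hD.preimage_mem_nhds_zero (Cp.ofBounded (X := X)))
  refine ⟨δ / 2, by positivity, fun f hf => ?_⟩
  let g : BoundedContinuousFunction X 𝕜 :=
    BoundedContinuousFunction.ofNormedAddCommGroup f.1 f.2 (δ / 2) hf
  have hg : g ∈ Metric.ball (0 : BoundedContinuousFunction X 𝕜) δ := by
    rw [mem_ball_zero_iff]
    exact (BoundedContinuousFunction.norm_ofNormedAddCommGroup_le _ (by positivity) hf).trans_lt
      (half_lt_self hδ)
  exact h hg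

section LocallyFiniteSum

variable (h : X → ℝ) (f : ℕ → Cp X 𝕜)

/-- The pointwise sum `∑ c n • f n` for a sequence of functions such that `f n` vanishes where
`|h| ≤ n`. -/
noncomputable def locallyFiniteSum (c : ℕ → 𝕜) (x : X) : 𝕜 :=
  ∑ n ∈ Finset.range ⌈|h x|⌉₊, c n * (f n).1 x

variable {h f}

theorem locallyFiniteSum_eq_sum_range (hf : ∀ (n : ℕ) x, |h x| ≤ n → (f n).1 x = 0) (c : ℕ → 𝕜)
    {x : X} {M : ℕ} (hM : |h x| ≤ M) :
    locallyFiniteSum h f c x = ∑ n ∈ Finset.range M, c n * (f n).1 x := by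
  refine Finset.sum_subset (Finset.range_subset_range.2 (Nat.ceil_le.2 hM)) fun n _ hn => ?_
  rw [hf n x ((Nat.le_ceil _).trans (by simpa using hn)), mul_zero]

theorem continuous_locallyFiniteSum (hh : Continuous h)
    (hf : ∀ (n : ℕ) x, |h x| ≤ n → (f n).1 x = 0) (c : ℕ → 𝕜) :
    Continuous (locallyFiniteSum h f c) := by
  refine continuous_iff_continuousAt.2 fun x => ?_
  obtain ⟨M, hM⟩ := exists_nat_gt |h x|
  have hc : Continuous fun y => ∑ n ∈ Finset.range M, c n * (f n).1 y :=
    continuous_finsetSum _ fun n _ => continuous_const.mul (f n).continuous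
  refine hc.continuousAt.congr ?_
  filter_upwards [hh.abs.continuousAt.eventually_lt_const hM] with y hy
  exact (locallyFiniteSum_eq_sum_range hf c hy.le).symm

/-- `locallyFiniteSum` as a continuous linear map from the space of all sequences. -/
noncomputable def locallyFiniteSumCLM (hh : Continuous h) (hf : ∀ (n : ℕ) x, |h x| ≤ n → (f n).1 x = 0) :
    (ℕ → 𝕜) →L[𝕜] Cp X 𝕜 where
  toFun c := ⟨locallyFiniteSum h f c, continuous_locallyFiniteSum hh hf c⟩
  map_add' c d := Subtype.ext <| funext fun x => by
    simp [locallyFiniteSum, add_mul, Finset.sum_add_distrib]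
  map_smul' c d := Subtype.ext <| funext fun x => by
    simp [locallyFiniteSum, mul_assoc, Finset.mul_sum]
  cont := Continuous.subtype_mk (continuous_pi fun x => continuous_finsetSum _ fun n _ =>
    (continuous_apply n).mul continuous_const) _

theorem locallyFiniteSumCLM_single (hh : Continuous h)
    (hf : ∀ (n : ℕ) x, |h x| ≤ n → (f n).1 x = 0) (n : ℕ) :
    locallyFiniteSumCLM hh hf (Pi.single n 1) = f n := by
  refine Subtype.ext <| funext fun x => ?_
  change locallyFiniteSum h f _ x = _
  rw [locallyFiniteSum_eq_sum_range hf _ ((Nat.le_ceil _).trans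
    (Nat.cast_le.2 (Nat.le_add_right ⌈|h x|⌉₊ (n + 1)))),
    Finset.sum_eq_single n (fun m _ hm => by simp [hm]) (fun hn => by simp at hn; omega)]
  simp

end LocallyFiniteSum

/-- Counterexamples for all `N` would form a locally finite family, hence a continuous linear map
from the Baire space of all sequences. The unit vectors tend to zero there, so some counterexample
would lie in `D`. -/
theorem IsBarrel.exists_nat_forall_vanishing_mem {D : Set (Cp X 𝕜)} (hD : IsBarrel 𝕜 D)
    {h : X → ℝ} (hh : Continuous h) :
    ∃ N : ℕ, ∀ f : Cp X 𝕜, (∀ x, |h x| ≤ N → f.1 x = 0) → f ∈ D := by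
  by_contra! hcon
  choose f hf hfD using hcon
  have hlim : Tendsto (fun n : ℕ => (Pi.single n 1 : ℕ → 𝕜)) atTop (𝓝 0) := by
    refine tendsto_pi_nhds.2 fun m => tendsto_const_nhds.congr' ?_
    filter_upwards [eventually_gt_atTop m] with n hn
    simp [hn.ne]
  obtain ⟨n, hn⟩ :=
    (hlim.eventually (hD.preimage_mem_nhds_zero (locallyFiniteSumCLM hh hf))).exists
  rw [locallyFiniteSumCLM_single] at hn
  exact hfD n hn

/-- The points all of whose neighborhoods carry a function outside of `D`. -/
def barrelSupport (D : Set (Cp X 𝕜)) : Set X :=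
  {x | ∀ U : Set X, IsOpen U → x ∈ U → ∃ f : Cp X 𝕜, (∀ y ∉ U, f.1 y = 0) ∧ f ∉ D}

theorem IsBarrel.isFunctionallyBounded_barrelSupport {D : Set (Cp X 𝕜)} (hD : IsBarrel 𝕜 D) :
    IsFunctionallyBounded (barrelSupport D) := by
  intro h hh
  obtain ⟨N, hN⟩ := hD.exists_nat_forall_vanishing_mem hh
  refine isBounded_iff_forall_norm_le.2 ⟨N, ?_⟩
  rintro _ ⟨x, hx, rfl⟩
  by_contra! hlt
  obtain ⟨f, hf, hfD⟩ := hx {y | (N : ℝ) < |h y|} (isOpen_lt continuous_const hh.abs) hlt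
  exact hfD (hN f fun y hy => hf y (not_lt.2 hy))

theorem exists_cp_eq_one_of_notMem [CompletelyRegularSpace X] {x : X} {C : Set X}
    (hC : IsClosed C) (hx : x ∉ C) :
    ∃ φ : Cp X 𝕜, φ.1 x = 1 ∧ ∀ y ∈ C, φ.1 y = 0 := by
  obtain ⟨u, hu, hux, huC⟩ := CompletelyRegularSpace.completely_regular x C hC hx
  refine ⟨⟨fun y => ((1 - (u y : ℝ) : ℝ) : 𝕜),
    RCLike.continuous_ofReal.comp (continuous_const.sub (continuous_subtype_val.comp hu))⟩, ?_, ?_⟩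
  · simp [hux]
  · intro y hy
    simp [huC hy]

/-- Off the support, a bump concentrated near a point has all its multiples in `D`. Sums of such
bumps interpolate `f` on any finite set, so `f` is a pointwise limit of elements of the closed
lineality space. -/
theorem IsBarrel.mem_linealitySpace_of_vanishing [T35Space X] {D : Set (Cp X 𝕜)}
    (hD : IsBarrel 𝕜 D) {f : Cp X 𝕜} (hf : ∀ x ∈ barrelSupport D, f.1 x = 0) :
    f ∈ hD.linealitySpace := by
  classical
  have key (S : Finset X) : ∃ g ∈ hD.linealitySpace, ∀ x ∈ S, g.1 x = f.1 x := by
    have hbump (x : X) : ∃ g ∈ hD.linealitySpace, g.1 x = f.1 x ∧ ∀ y ∈ S.erase x, g.1 y = 0 := by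
      by_cases hx : x ∈ barrelSupport D
      · exact ⟨0, zero_mem _, (hf x hx).symm, fun _ _ => rfl⟩
      · simp only [barrelSupport, Set.mem_ofPred_eq] at hx
        push Not at hx
        obtain ⟨U, hU, hxU, hUD⟩ := hx
        obtain ⟨φ, hφx, hφ⟩ := exists_cp_eq_one_of_notMem (𝕜 := 𝕜) (x := x)
          (hU.isClosed_compl.union (S.erase x).finite_toSet.isClosed) (by simp [hxU])
        refine ⟨f.1 x • φ, fun c => hUD _ fun y hy => ?_, ?_, fun y hy => ?_⟩
        · simp [hφ y (Or.inl hy)]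
        · simp [hφx]
        · simp [hφ y (Or.inr hy)]
    choose g hgL hgx hgS using hbump
    refine ⟨∑ x ∈ S, g x, sum_mem fun x _ => hgL x, fun x hx => ?_⟩
    rw [← Cp.eval_apply, map_sum, Finset.sum_eq_single_of_mem x hx]
    · exact hgx x
    · intro y _ hyx
      exact hgS y x (Finset.mem_erase.2 ⟨hyx.symm, hx⟩)
  choose g hgL hgS using key
  refine hD.isClosed_linealitySpace.mem_of_tendsto (f := g) (b := atTop) ?_
    (Eventually.of_forall hgL)
  refine tendsto_subtype_rng.2 (tendsto_pi_nhds.2 fun x => tendsto_const_nhds.congr' ?_)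
  filter_upwards [eventually_ge_atTop {x}] with S hS
  exact (hgS S x (hS (Finset.mem_singleton_self x))).symm

/-- Every barrel of `C_p(X)` is a neighborhood of zero for uniform convergence on functionally
bounded sets. -/
theorem IsBarrel.exists_isFunctionallyBounded [T35Space X] {D : Set (Cp X 𝕜)}
    (hD : IsBarrel 𝕜 D) :
    ∃ B : Set X, IsFunctionallyBounded B ∧
      ∃ ε > 0, ∀ f : Cp X 𝕜, (∀ x ∈ B, ‖f.1 x‖ ≤ ε) → f ∈ D := by
  obtain ⟨ε, hε, hεD⟩ := hD.exists_forall_norm_le_mem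
  refine ⟨_, hD.isFunctionallyBounded_barrelSupport, ε / 2, by positivity, fun f hf => ?_⟩
  have hpos (z : 𝕜) : 0 < max ‖z‖ (ε / 2) := lt_max_of_lt_right (by positivity)
  -- Radial truncation of `f` at norm `ε / 2`: `2 • r` is uniformly bounded by `ε`, and `f - r`
  -- vanishes on the support.
  let r : Cp X 𝕜 := ⟨fun x => ((ε / 2 / max ‖f.1 x‖ (ε / 2) : ℝ) : 𝕜) * f.1 x,
    (RCLike.continuous_ofReal.comp (continuous_const.div
      (f.continuous.norm.max continuous_const) fun x => (hpos _).ne')).mul f.continuous⟩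
  have hr (x : X) : r.1 x = ((ε / 2 / max ‖f.1 x‖ (ε / 2) : ℝ) : 𝕜) * f.1 x := rfl
  have hrD : (2 : 𝕜) • r ∈ D := by
    refine hεD _ fun x => ?_
    change ‖(2 : 𝕜) * r.1 x‖ ≤ ε
    rw [hr, norm_mul, norm_mul, RCLike.norm_ofReal, RCLike.norm_ofNat,
      abs_of_nonneg (div_nonneg (by positivity) (hpos _).le), div_mul_eq_mul_div]
    have : ε / 2 * ‖f.1 x‖ / max ‖f.1 x‖ (ε / 2) ≤ ε / 2 := by
      rw [div_le_iff₀ (hpos _)]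
      gcongr
      exact le_max_left _ _
    linarith
  have hfr : f - r ∈ hD.linealitySpace := hD.mem_linealitySpace_of_vanishing fun x hx => by
    change f.1 x - r.1 x = 0
    rw [hr, max_eq_right (hf x hx), div_self (by positivity)]
    simp
  simpa using hD.add_mem_of_two_smul hrD (hfr 2)

/-! ### Limited sets and precompactness -/

theorem isBarrel_norm_eval_le_one (x : X) : IsBarrel 𝕜 {f : Cp X 𝕜 | ‖f.1 x‖ ≤ 1} := by
  have h : {f : Cp X 𝕜 | ‖f.1 x‖ ≤ 1} =
      (Cp.eval x : Cp X 𝕜 →L[𝕜] 𝕜) ⁻¹' Metric.closedBall 0 1 := by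
    ext f; simp
  rw [h]
  refine ⟨Metric.isClosed_closedBall.preimage (Cp.eval x).continuous, ?_, ?_, ?_⟩
  · exact balanced_iff_smul_mem.2 fun c hc f hf => by
      rw [Set.mem_preimage, map_smul]
      exact balanced_iff_smul_mem.1 balanced_closedBall_zero hc hf
  · exact (convex_closedBall (0 : 𝕜) 1).is_linear_preimage
      ⟨fun _ _ => rfl, fun _ _ => rfl⟩
  · exact absorbent_nhds_zero ((Cp.eval x).continuous.continuousAt.preimage_mem_nhds
      (by simpa using Metric.closedBall_mem_nhds (0 : 𝕜) one_pos))

theorem IsBarrelBounded.exists_forall_norm_le {A : Set (Cp X 𝕜)} (hA : IsBarrelBounded 𝕜 A)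
    (x : X) : ∃ C : ℝ, ∀ f ∈ A, ‖f.1 x‖ ≤ C := by
  obtain ⟨n, hn⟩ := hA _ (isBarrel_norm_eval_le_one x)
  refine ⟨n, fun f hf => ?_⟩
  obtain ⟨g, hg, rfl⟩ := hn hf
  change ‖(n : 𝕜) * g.1 x‖ ≤ n
  rw [norm_mul, RCLike.norm_natCast]
  exact mul_le_of_le_one_right n.cast_nonneg hg

theorem IsLimitedSet.exists_forall_norm_sub_lt {A : Set (Cp X 𝕜)} (hA : IsLimitedSet 𝕜 A)
    {y : ℕ → X} {l : X} (hy : Tendsto y atTop (𝓝 l)) {ε : ℝ} (hε : 0 < ε) :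
    ∀ᶠ n in atTop, ∀ f ∈ A, ‖f.1 (y n) - f.1 l‖ < ε := by
  let χ : ℕ → WeakDual 𝕜 (Cp X 𝕜) := fun n =>
    StrongDual.toWeakDual (Cp.eval (y n) - Cp.eval l : Cp X 𝕜 →L[𝕜] 𝕜)
  have hχ (n : ℕ) (f : Cp X 𝕜) : χ n f = f.1 (y n) - f.1 l := rfl
  have hlim : Tendsto χ atTop (𝓝 0) := by
    refine WeakBilin.tendsto_iff_forall_eval_tendsto _ ContinuousLinearMap.coe_injective |>.2
      fun f => ?_
    have : Tendsto (fun n => f.1 (y n) - f.1 l) atTop (𝓝 (f.1 l - f.1 l)) :=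
      ((f.continuous.tendsto l).comp hy).sub_const _
    rw [sub_self] at this
    exact this
  filter_upwards [Metric.tendstoUniformlyOn_iff.1 (hA.2 χ hlim) ε hε] with n hn f hf
  simpa [hχ, dist_eq_norm, norm_sub_rev] using hn f hf

theorem IsFunctionallyBounded.exists_forall_norm_le {B : Set X} (hB : IsFunctionallyBounded B)
    (f : Cp X 𝕜) : ∃ C : ℝ, ∀ x ∈ B, ‖f.1 x‖ ≤ C := by
  obtain ⟨C, hC⟩ := isBounded_iff_forall_norm_le.1 (hB _ f.continuous.norm)
  exact ⟨C, fun x hx => by simpa using hC _ ⟨x, hx, rfl⟩⟩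

/-- A sequence in a functionally bounded set has a subsequence along which countably many given
continuous functions converge. -/
theorem IsFunctionallyBounded.exists_subseq_tendsto {B : Set X} (hB : IsFunctionallyBounded B)
    {ι : Type*} [Countable ι] (f : ι → Cp X 𝕜) {x : ℕ → X} (hx : ∀ n, x n ∈ B) :
    ∃ (a : ι → 𝕜) (ψ : ℕ → ℕ), StrictMono ψ ∧
      ∀ i, Tendsto (fun n => (f i).1 (x (ψ n))) atTop (𝓝 (a i)) := by
  choose C hC using fun i => hB.exists_forall_norm_le (f i)
  obtain ⟨a, -, ψ, hψ, ha⟩ := (isCompact_univ_pi fun i =>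
    isCompact_closedBall (0 : 𝕜) (C i)).tendsto_subseq (x := fun n i => (f i).1 (x n))
    (fun n i _ => by simpa using hC i _ (hx n))
  exact ⟨a, ψ, hψ, tendsto_pi_nhds.1 ha⟩

/-- Points of `K` cannot be kept uniformly away, by functions from a limited set, from the values
at infinity of these functions along the sequence of these points. -/
theorem IsLimitedSet.not_forall_lt_norm_sub {A : Set (Cp X 𝕜)} (hA : IsLimitedSet 𝕜 A)
    {K : Set X} (hK : SelSeqPseudocompactAt K) {ε : ℝ} (hε : 0 < ε) {x : ℕ → X}
    (hx : ∀ n, x n ∈ K) {g : ℕ → Cp X 𝕜} (hg : ∀ n, g n ∈ A) {a : ℕ → 𝕜}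
    (ha : ∀ i, Tendsto (fun n => (g i).1 (x n)) atTop (𝓝 (a i))) :
    ¬ ∀ n, ε < ‖(g n).1 (x n) - a n‖ := by
  intro hsep
  -- Only `g 0, …, g n` are controlled on `U n`, which keeps it open; for each fixed `i` this still
  -- forces `g i` to have the same limit along the selected points as along `x`.
  let U : ℕ → Set X := fun n =>
    ⋂ i ∈ Finset.range (n + 1), {y | ‖(g i).1 y - (g i).1 (x n)‖ < 1 / ((n : ℝ) + 1)}
  obtain ⟨y, hyU, φ, hφ, l, hl⟩ := hK U
    (fun n => isOpen_biInter_finset fun i _ =>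
      isOpen_lt ((g i).continuous.sub continuous_const).norm continuous_const)
    (fun n => ⟨x n, Set.mem_iInter₂.2 fun i _ => by simp; positivity, hx n⟩)
  have hy {n i : ℕ} (hi : i ≤ n) : ‖(g i).1 (y n) - (g i).1 (x n)‖ < 1 / ((n : ℝ) + 1) :=
    Set.mem_iInter₂.1 (hyU n) i (Finset.mem_range.2 (Nat.lt_succ_of_le hi))
  have hzero : Tendsto (fun k => 1 / ((φ k : ℝ) + 1)) atTop (𝓝 0) :=
    (tendsto_one_div_add_atTop_nhds_zero_nat (𝕜 := ℝ)).comp hφ.tendsto_atTop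
  have hal (i : ℕ) : (g i).1 l = a i := by
    have h1 : Tendsto (fun k => (g i).1 (y (φ k)) - (g i).1 (x (φ k))) atTop (𝓝 0) := by
      refine squeeze_zero_norm' ?_ hzero
      filter_upwards [eventually_ge_atTop i] with k hk
      exact (hy (hk.trans hφ.le_apply)).le
    have h2 := h1.add ((ha i).comp hφ.tendsto_atTop)
    simp only [Function.comp_def, sub_add_cancel, zero_add] at h2
    exact tendsto_nhds_unique (((g i).continuous.tendsto l).comp hl) h2
  obtain ⟨k, hk1, hk2⟩ := ((hA.exists_forall_norm_sub_lt hl (half_pos hε)).and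
    (hzero.eventually_lt_const (half_pos hε))).exists
  have h1 := hk1 _ (hg (φ k))
  have h2 := hy (le_refl (φ k))
  have h3 := hsep (φ k)
  rw [hal] at h1
  have h4 := norm_sub_le_norm_sub_add_norm_sub ((g (φ k)).1 (x (φ k))) ((g (φ k)).1 (y (φ k)))
    (a (φ k))
  rw [norm_sub_rev] at h2
  linarith

/-- A functionally bounded subset of a set at which `X` is selectively sequentially pseudocompact
is precompact for uniform convergence on limited sets. -/
theorem IsLimitedSet.exists_finset_net {A : Set (Cp X 𝕜)} (hA : IsLimitedSet 𝕜 A) {B K : Set X}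
    (hB : IsFunctionallyBounded B) (hBK : B ⊆ K) (hK : SelSeqPseudocompactAt K) {ε : ℝ}
    (hε : 0 < ε) :
    ∃ S : Finset X, ∀ x ∈ B, ∃ z ∈ S, ∀ f ∈ A, ‖f.1 x - f.1 z‖ ≤ ε := by
  by_contra! hcon
  obtain ⟨x, hxB, hsep⟩ := exists_seq_of_forall_finset_exists (· ∈ B)
    (fun z x => ∃ f ∈ A, ε < ‖f.1 x - f.1 z‖) fun S _ => hcon S
  choose f hfA hf using fun p : {p : ℕ × ℕ // p.1 < p.2} => hsep p.1.1 p.1.2 p.2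
  obtain ⟨a, ψ, hψ, ha⟩ := hB.exists_subseq_tendsto f hxB
  -- The function separating two consecutive terms by more than `ε` cannot be within `ε / 2` of its
  -- limit `a p` at both.
  have hfar (n : ℕ) : ∃ m ≥ n, ∃ p, ε / 2 < ‖(f p).1 (x (ψ m)) - a p‖ := by
    let p : {p : ℕ × ℕ // p.1 < p.2} := ⟨(ψ n, ψ (n + 1)), hψ n.lt_succ_self⟩
    by_contra! hc
    have h1 := hc n le_rfl p
    have h2 := hc (n + 1) n.le_succ p
    have h3 : ε < ‖(f p).1 (x (ψ (n + 1))) - (f p).1 (x (ψ n))‖ := hf p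
    have h4 := norm_sub_le_norm_sub_add_norm_sub ((f p).1 (x (ψ (n + 1)))) (a p)
      ((f p).1 (x (ψ n)))
    rw [norm_sub_rev (a p)] at h4
    linarith
  choose m hmn p hp using hfar
  have hm : Tendsto m atTop atTop := tendsto_atTop_mono hmn tendsto_id
  exact hA.not_forall_lt_norm_sub hK (half_pos hε) (x := fun n => x (ψ (m n)))
    (fun n => hBK (hxB _)) (g := fun n => f (p n)) (fun n => hfA _) (a := fun n => a (p n))
    (fun i => (ha (p i)).comp hm) hp

/-- Restricting `A` to `S` gives a bounded set in a finite-dimensional space. The centres are taken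
in `A` so that uniform estimates over `A` apply to them too. -/
theorem IsBarrelBounded.exists_finite_forall_norm_sub_lt {A : Set (Cp X 𝕜)}
    (hA : IsBarrelBounded 𝕜 A) (S : Finset X) {ε : ℝ} (hε : 0 < ε) :
    ∃ t : Set (Cp X 𝕜), t.Finite ∧ t ⊆ A ∧ ∀ f ∈ A, ∃ g ∈ t, ∀ z ∈ S, ‖f.1 z - g.1 z‖ < ε := by
  choose C hC using fun x => hA.exists_forall_norm_le x
  let ρ : Cp X 𝕜 → S → 𝕜 := fun f z => f.1 z
  have htb : TotallyBounded (ρ '' A) :=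
    (isCompact_univ_pi fun z : S => isCompact_closedBall (0 : 𝕜) (C z)).totallyBounded.subset <| by
      rintro _ ⟨f, hf, rfl⟩ z -
      simpa using hC z f hf
  obtain ⟨t, htA, ht, hcover⟩ := Set.exists_subset_image_finite_and.1
    (Metric.finite_approx_of_totallyBounded htb ε hε)
  refine ⟨t, ht, htA, fun f hf => ?_⟩
  obtain ⟨_, ⟨g, hg, rfl⟩, hfg⟩ := Set.mem_iUnion₂.1 (hcover ⟨f, hf, rfl⟩)
  refine ⟨g, hg, fun z hz => ?_⟩
  have := (dist_pi_lt_iff hε).1 hfg ⟨z, hz⟩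
  rwa [dist_eq_norm] at this

end FunctionSpaces

theorem theorem3p3 (𝕜 : Type*) [RCLike 𝕜] (X : Type*) [TopologicalSpace X] [T35Space X]
    (hX : ∀ K : Set X, IsFunctionallyBounded K →
      ∃ K' : Set X, K ⊆ K' ∧ SelSeqPseudocompactAt K') :
    IsGelfandPhillips 𝕜 (Cp X 𝕜) := by
  intro A hA D hD
  obtain ⟨B, hB, ε, hε, hBD⟩ := hD.exists_isFunctionallyBounded
  obtain ⟨K, hBK, hK⟩ := hX B hB
  have hε3 : 0 < ε / 3 := by positivity
  obtain ⟨S, hS⟩ := hA.exists_finset_net hB hBK hK hε3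
  obtain ⟨t, ht, htA, hcover⟩ := hA.1.exists_finite_forall_norm_sub_lt S hε3
  refine ⟨t, ht, fun f hf => ?_⟩
  obtain ⟨g, hg, hfg⟩ := hcover f hf
  refine Set.mem_add.2 ⟨g, hg, f - g, hBD _ fun x hx => ?_, add_sub_cancel g f⟩
  obtain ⟨z, hz, hxz⟩ := hS x hx
  have h1 := hxz f hf
  have h2 := hxz g (htA hg)
  have h3 := hfg z hz
  change ‖f.1 x - g.1 x‖ ≤ ε
  have e : f.1 x - g.1 x = f.1 x - f.1 z + (f.1 z - g.1 z) - (g.1 x - g.1 z) := by ring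
  rw [e]
  have h4 := norm_sub_le (f.1 x - f.1 z + (f.1 z - g.1 z)) (g.1 x - g.1 z)
  have h5 := norm_add_le (f.1 x - f.1 z) (f.1 z - g.1 z)
  linarith
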